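/- Work with real vector fields on $\mathbb{R}^3$; curl $\nabla\wedge$, divergence $\nabla\cdot$ and gradient $\nabla$ are understood in the sense of distributions. Let $$\mathcal Y=\{A\in L^3(\mathbb{R}^3,\mathbb{R}^3):\ \nabla\wedge A\in L^{3/2}(\mathbb{R}^3,\mathbb{R}^3)\},$$ let $|\!|\!|A|\!|\!|_3=\inf_\phi\|A-\nabla\phi\|_3$, where the infimum is over all real $\phi\in L^1_{\rm loc}(\mathbb{R}^3)$ with $\nabla\phi\in L^3(\mathbb{R}^3,\mathbb{R}^3)$, and let $$S=\inf\left\{\frac{\|\nabla\wedge A\|_{3/2}^{3/2}}{|\!|\!|A|\!|\!|_3^{3/2}}:\ A\in\mathcal Y,\ |\!|\!|A|\!|\!|_3\neq0\right\}.$$ Let $(A_n)\subset\mathcal Y$ be a minimizing sequence for $S$ (that is, the quotients of the $A_n$ converge to $S$) with $|\!|\!|A_n|\!|\!|_3=1$ for all $n$. Then there are a sequence $(A_n')\subset\mathcal Y$ and a sequence $(r_n)\subset L^3(\mathbb{R}^3,\mathbb{R}^3)$ such that, for all $n$, $\nabla\cdot(|A_n'|A_n')=0$ and $\|A_n'\|_3=1$,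 such that $$\nabla\wedge A_n'-\nabla\wedge A_n\to0\quad\text{in }L^{3/2}(\mathbb{R}^3,\mathbb{R}^3),\qquad r_n\to0\quad\text{in }L^3(\mathbb{R}^3,\mathbb{R}^3),$$ and such that, for all $n$, in the sense of distributions, $$\nabla\wedge\left(|\nabla\wedge A_n'|^{-1/2}\,\nabla\wedge A_n'\right)-S\,|A_n'|A_n'=\nabla\wedge r_n ,$$ where $|\nabla\wedge A_n'|^{-1/2}\,\nabla\wedge A_n'$ is understood as $0$ where $\nabla\wedge A_n'=0$. -/

import Mathlib

open MeasureTheory Filter Topology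
open scoped ContDiff ENNReal

noncomputable section

namespace CurlSobolev

/-- Three-dimensional Euclidean space. -/
abbrev E3 : Type := EuclideanSpace ℝ (Fin 3)

/-- The partial derivative `∂_i V_j` of a differentiable vector field. -/
def partialDeriv (i j : Fin 3) (V : E3 → E3) (x : E3) : ℝ :=
  (fderiv ℝ V x (EuclideanSpace.single i 1)) j

/-- The classical curl of a differentiable vector field. -/
def curl (V : E3 → E3) (x : E3) : E3 :=
  !₂[partialDeriv 1 2 V x - partialDeriv 2 1 V x,
     partialDeriv 2 0 V x - partialDeriv 0 2 V x,
     partialDeriv 0 1 V x - partialDeriv 1 0 V x]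

/-- Test functions: smooth and compactly supported, scalar- or vector-valued. -/
def IsTest {F : Type*} [NormedAddCommGroup F] [NormedSpace ℝ F] (φ : E3 → F) : Prop :=
  ContDiff ℝ ∞ φ ∧ HasCompactSupport φ

/-- `∇ ∧ A = B` in the sense of distributions, for locally integrable `A` and `B`. -/
def HasWeakCurl (A B : E3 → E3) : Prop :=
  LocallyIntegrable A ∧ LocallyIntegrable B ∧
    ∀ Φ : E3 → E3, IsTest Φ → ∫ x, inner ℝ (A x) (curl Φ x) = ∫ x, inner ℝ (B x) (Φ x)

open Classical in
/-- The distributional curl of `A` when it is a locally integrable function (and `0` otherwise).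
It is determined up to equality almost everywhere, see `HasWeakCurl.ae_eq`. -/
def weakCurl (A : E3 → E3) : E3 → E3 :=
  if h : ∃ B, HasWeakCurl A B then h.choose else 0

/-- `∇φ = G` in the sense of distributions, for locally integrable `φ` and `G`. -/
def HasWeakGradient (φ : E3 → ℝ) (G : E3 → E3) : Prop :=
  LocallyIntegrable φ ∧ LocallyIntegrable G ∧
    ∀ η : E3 → ℝ, IsTest η → ∫ x, φ x • gradient η x = -∫ x, η x • G x

/-- `∇ · V = 0` in the sense of distributions, for locally integrable `V`. -/
def WeaklyDivFree (V : E3 → E3) : Prop :=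
  LocallyIntegrable V ∧ ∀ η : E3 → ℝ, IsTest η → ∫ x, inner ℝ (V x) (gradient η x) = 0

/-- The space `𝒴` of all `A ∈ L³(ℝ³, ℝ³)` with distributional curl in `L^{3/2}`. -/
def MemY (A : E3 → E3) : Prop :=
  MemLp A 3 ∧ ∃ B, MemLp B (3 / 2) ∧ HasWeakCurl A B

/-- The gauge-invariant seminorm `⦀A⦀₃ = inf_φ ‖A - ∇φ‖₃`, the infimum being over all
`φ ∈ L¹_loc` with distributional gradient in `L³`. -/
def gaugeSeminorm (A : E3 → E3) : ℝ :=
  sInf {r : ℝ | ∃ (φ : E3 → ℝ) (G : E3 → E3),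
    HasWeakGradient φ G ∧ MemLp G 3 ∧ r = lpNorm (A - G) 3 volume}

/-- The quotient `‖∇ ∧ A‖_{3/2}^{3/2} / ⦀A⦀₃^{3/2}`. -/
def sobolevQuotient (A : E3 → E3) : ℝ :=
  lpNorm (weakCurl A) (3 / 2) volume ^ (3 / 2 : ℝ) / gaugeSeminorm A ^ (3 / 2 : ℝ)

/-- The constant `S`: the infimum of the quotient over all `A ∈ 𝒴` for which it makes sense. -/
def sobolevConst : ℝ :=
  sInf {q : ℝ | ∃ A : E3 → E3, MemY A ∧ gaugeSeminorm A ≠ 0 ∧ q = sobolevQuotient A}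

/-- `(A_n)` is a minimizing sequence for `S`. -/
def IsMinimizingSeq (A : ℕ → E3 → E3) : Prop :=
  (∀ n, MemY (A n) ∧ gaugeSeminorm (A n) ≠ 0) ∧
    Tendsto (fun n => sobolevQuotient (A n)) atTop (𝓝 sobolevConst)

theorem HasWeakCurl.weakCurl {A B : E3 → E3} (h : HasWeakCurl A B) :
    HasWeakCurl A (weakCurl A) := by
  have hex : ∃ B, HasWeakCurl A B := ⟨B, h⟩
  have := hex.choose_spec
  simpa [CurlSobolev.weakCurl, hex] using this

theorem HasWeakCurl.ae_eq {A B C : E3 → E3} (hB : HasWeakCurl A B) (hC : HasWeakCurl A C) :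
    B =ᵐ[volume] C := by
  have key : ∀ i : Fin 3, ∀ᵐ x, B x i = C x i := by
    intro i
    have hBi : LocallyIntegrable (fun x => B x i) := by
      intro x
      obtain ⟨s, hs, h⟩ := hB.2.1 x
      exact ⟨s, hs, (EuclideanSpace.proj (𝕜 := ℝ) i).integrable_comp h⟩
    have hCi : LocallyIntegrable (fun x => C x i) := by
      intro x
      obtain ⟨s, hs, h⟩ := hC.2.1 x
      exact ⟨s, hs, (EuclideanSpace.proj (𝕜 := ℝ) i).integrable_comp h⟩
    refine ae_eq_of_integral_contDiff_smul_eq hBi hCi fun g hg hgs => ?_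
    have hT : IsTest (fun x => g x • (EuclideanSpace.single i (1 : ℝ) : E3)) :=
      ⟨hg.smul contDiff_const, hgs.smul_right⟩
    have := (hB.2.2 _ hT).symm.trans (hC.2.2 _ hT)
    simpa [inner_smul_right, EuclideanSpace.inner_single_right] using this
  filter_upwards [ae_all_iff.2 key] with x hx
  ext i
  exact hx i

end CurlSobolev

end

/-
Subtract from `A_n` its nearest gradient. The difference `A_n'` has the same curl `b` and norm `1`,
and by minimality `|A_n'| A_n'` annihilates all gradients. The functional
`∇ ∧ V ↦ S ∫ |A_n'| A_n' · V` is then well defined on curls and, by the Sobolev inequality, of norm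
at most `S^{1/3}` for the `L^{3/2}` norm; let `g` be a Hahn-Banach extension of it to `L^{3/2}`.
It satisfies `‖g‖^3 ≤ S = g(b)`, whereas `f = |b|^{-1/2} b` satisfies `‖f‖^3 = f(b) = ‖b‖^{3/2}`.
As `‖b‖^{3/2} → S`, both functionals almost attain their norm at the same vector, so Clarkson's
inequality in the dual of `L^{3/2}` makes `r_n = f - g` small.
-/

noncomputable section

section Clarkson

theorem norm_smul_rpow_of_nonneg {X : Type*} [SeminormedAddGroup X] [SMul ℝ X]
    [NormSMulClass ℝ X] {c : ℝ} (hc : 0 ≤ c) (x : X) (r : ℝ) : ‖c • x‖ ^ r = c ^ r * ‖x‖ ^ r := by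
  rw [norm_smul, Real.norm_of_nonneg hc, Real.mul_rpow hc (norm_nonneg x)]

/-- Clarkson's inequality with exponent `r` and constant `C`. With `C = 2 ^ (r - 1)` it is an
equality at `y = 0` and at `x = y`, and expresses uniform convexity quantitatively. -/
def ClarksonWith (X : Type*) [NormedAddCommGroup X] (r C : ℝ) : Prop :=
  ∀ x y : X, ‖x + y‖ ^ r + ‖x - y‖ ^ r ≤ C * (‖x‖ ^ r + ‖y‖ ^ r)

theorem ClarksonWith.of_isometry {X Y : Type*} [NormedAddCommGroup X] [NormedAddCommGroup Y]
    {r C : ℝ} (h : ClarksonWith Y r C) (T : X →+ Y) (hT : ∀ x, ‖T x‖ = ‖x‖) :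
    ClarksonWith X r C := fun x y => by
  simpa only [← map_add, ← map_sub, hT] using h (T x) (T y)

theorem clarksonWith_of_inner {E : Type*} [NormedAddCommGroup E] [InnerProductSpace ℝ E] {p : ℝ}
    (hp : 2 ≤ p) : ClarksonWith E p (2 ^ (p - 1)) := by
  intro x y
  have sq_rpow (t : ℝ) (ht : 0 ≤ t) : t ^ p = (t ^ 2) ^ (p / 2) := by
    rw [← Real.rpow_natCast_mul ht]; norm_num [mul_div_cancel₀]
  calc ‖x + y‖ ^ p + ‖x - y‖ ^ p
      ≤ (‖x + y‖ ^ 2 + ‖x - y‖ ^ 2) ^ (p / 2) := by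
        rw [sq_rpow _ (norm_nonneg _), sq_rpow _ (norm_nonneg _)]
        exact Real.add_rpow_le_rpow_add (sq_nonneg _) (sq_nonneg _) (by linarith)
    _ = (2 * (‖x‖ ^ 2 + ‖y‖ ^ 2)) ^ (p / 2) := by rw [parallelogram_law_with_norm ℝ]
    _ = 2 ^ p * ((1 / 2) * ‖x‖ ^ 2 + (1 / 2) * ‖y‖ ^ 2) ^ (p / 2) := by
        rw [sq_rpow 2 zero_le_two, ← Real.mul_rpow (by positivity) (by positivity)]
        ring_nf
    _ ≤ 2 ^ p * ((1 / 2) * (‖x‖ ^ 2) ^ (p / 2) + (1 / 2) * (‖y‖ ^ 2) ^ (p / 2)) := by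
        gcongr
        exact (convexOn_rpow (by linarith : 1 ≤ p / 2)).2 (sq_nonneg ‖x‖) (sq_nonneg ‖y‖)
          (by norm_num) (by norm_num) (by norm_num)
    _ = 2 ^ (p - 1) * (‖x‖ ^ p + ‖y‖ ^ p) := by
        rw [← sq_rpow _ (norm_nonneg x), ← sq_rpow _ (norm_nonneg y), Real.rpow_sub_one two_ne_zero]
        ring

end Clarkson

section Dual

variable {Y : Type*} [NormedAddCommGroup Y] [NormedSpace ℝ Y] {p q : ℝ}

theorem exists_apply_eq_norm_rpow (hpq : p.HolderConjugate q) (g : StrongDual ℝ Y) {η : ℝ}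
    (hη : 0 < η) : ∃ b : Y, g b = ‖g‖ ^ p ∧ ‖b‖ ^ q < ‖g‖ ^ p + η := by
  rcases (norm_nonneg g).eq_or_lt with hg | hg
  · refine ⟨0, ?_, ?_⟩
    · rw [map_zero, ← hg, Real.zero_rpow hpq.ne_zero]
    · rw [norm_zero, ← hg, Real.zero_rpow hpq.ne_zero, Real.zero_rpow hpq.symm.ne_zero]
      linarith
  have hlim : Tendsto (fun c : ℝ => (‖g‖ ^ p / c) ^ q) (𝓝[<] ‖g‖) (𝓝 (‖g‖ ^ p)) := by
    have hval : (‖g‖ ^ p / ‖g‖) ^ q = ‖g‖ ^ p := by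
      rw [← Real.rpow_sub_one hg.ne', ← Real.rpow_mul hg.le, hpq.sub_one_mul_conj]
    have hcont : ContinuousAt (fun c : ℝ => (‖g‖ ^ p / c) ^ q) ‖g‖ :=
      (continuousAt_const.div continuousAt_id hg.ne').rpow_const (.inr hpq.symm.nonneg)
    exact (hval ▸ hcont.tendsto).mono_left nhdsWithin_le_nhds
  obtain ⟨c, hcη, hcpos, hcg⟩ := ((hlim.eventually_lt_const (lt_add_of_pos_right _ hη)).and
    (Ioo_mem_nhdsLT hg)).exists
  obtain ⟨u, hu, hgu⟩ := g.exists_lt_apply_of_lt_opNorm hcg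
  have hgu0 : 0 < ‖g u‖ := hcpos.trans hgu
  refine ⟨(‖g‖ ^ p / g u) • u, ?_, ?_⟩
  · rw [map_smul, smul_eq_mul, div_mul_cancel₀ _ (norm_pos_iff.1 hgu0)]
  · refine lt_of_le_of_lt ?_ hcη
    refine Real.rpow_le_rpow (norm_nonneg _) ?_ hpq.symm.nonneg
    calc ‖(‖g‖ ^ p / g u) • u‖ = ‖g‖ ^ p / ‖g u‖ * ‖u‖ := by
          rw [norm_smul, norm_div, Real.norm_of_nonneg (by positivity)]
      _ ≤ ‖g‖ ^ p / c * 1 := by gcongr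
      _ = ‖g‖ ^ p / c := mul_one _

theorem apply_le_norm_rpow_add_norm_rpow (hpq : p.HolderConjugate q) (k : StrongDual ℝ Y) (b : Y) :
    k b ≤ ‖k‖ ^ p / p + ‖b‖ ^ q / q :=
  ((Real.le_norm_self _).trans (k.le_opNorm b)).trans
    (Real.young_inequality_of_nonneg (norm_nonneg _) (norm_nonneg _) hpq)

theorem ClarksonWith.strongDual (hpq : p.HolderConjugate q) {C : ℝ} (hC : 0 < C)
    (hY : ClarksonWith Y q C) : ClarksonWith (StrongDual ℝ Y) p (C ^ (p - 1)) := by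
  intro ℓ m
  set M := ‖ℓ + m‖ ^ p + ‖ℓ - m‖ ^ p with hM
  have hCq : (C ^ q⁻¹) ^ q = C := Real.rpow_inv_rpow hC.le hpq.symm.ne_zero
  have hCp : (C ^ q⁻¹) ^ p = C ^ (p - 1) := by
    rw [← Real.rpow_mul hC.le, inv_mul_eq_div, hpq.div_conj_eq_sub_one]
  have hC' : 0 < C ^ q⁻¹ := Real.rpow_pos_of_pos hC _
  have young (k : StrongDual ℝ Y) (w : Y) :
      k w ≤ C ^ (p - 1) * ‖k‖ ^ p / p + ‖w‖ ^ q / C / q := by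
    have h := apply_le_norm_rpow_add_norm_rpow hpq (C ^ q⁻¹ • k) ((C ^ q⁻¹)⁻¹ • w)
    rwa [smul_apply, map_smul, smul_inv_smul₀ hC'.ne', norm_smul_rpow_of_nonneg hC'.le,
      norm_smul_rpow_of_nonneg (inv_nonneg.2 hC'.le), Real.inv_rpow hC'.le, hCp, hCq,
      inv_mul_eq_div] at h
  have approx (η : ℝ) (hη : 0 < η) :
      M ≤ C ^ (p - 1) * (‖ℓ‖ ^ p + ‖m‖ ^ p) / p + (M + (η + η)) / q := by
    obtain ⟨u, hu, hu'⟩ := exists_apply_eq_norm_rpow hpq (ℓ + m) hη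
    obtain ⟨v, hv, hv'⟩ := exists_apply_eq_norm_rpow hpq (ℓ - m) hη
    calc M = ℓ (u + v) + m (u - v) := by
          rw [hM, ← hu, ← hv]; simp only [map_add, map_sub, add_apply, sub_apply]; ring
      _ ≤ C ^ (p - 1) * (‖ℓ‖ ^ p + ‖m‖ ^ p) / p + (‖u + v‖ ^ q + ‖u - v‖ ^ q) / C / q := by
          linear_combination young ℓ (u + v) + young m (u - v)
      _ ≤ C ^ (p - 1) * (‖ℓ‖ ^ p + ‖m‖ ^ p) / p + (M + (η + η)) / q := by
          have := hpq.symm.pos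
          gcongr
          rw [div_le_iff₀' hC]
          exact (hY u v).trans (mul_le_mul_of_nonneg_left (by linarith) hC.le)
  have hlim : Tendsto (fun η : ℝ => C ^ (p - 1) * (‖ℓ‖ ^ p + ‖m‖ ^ p) / p + (M + (η + η)) / q)
      (𝓝[>] 0) (𝓝 (C ^ (p - 1) * (‖ℓ‖ ^ p + ‖m‖ ^ p) / p + (M + (0 + 0)) / q)) :=
    (Continuous.tendsto (by fun_prop) 0).mono_left nhdsWithin_le_nhds
  have hle := ge_of_tendsto hlim (eventually_mem_nhdsWithin.mono approx)
  have hp := hpq.pos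
  have hconj : M = M / p + M / q := by
    rw [div_eq_mul_inv, div_eq_mul_inv, ← mul_add, hpq.inv_add_inv_eq_one, mul_one]
  rw [add_zero, add_zero] at hle
  exact (div_le_div_iff_of_pos_right hp).1 (by linarith)

theorem norm_sub_rpow_le_of_apply_eq (hpq : p.HolderConjugate q)
    (hY : ClarksonWith (StrongDual ℝ Y) p (2 ^ (p - 1))) {f g : StrongDual ℝ Y} {b : Y} {S : ℝ}
    (hf : ‖f‖ ^ p ≤ ‖b‖ ^ q) (hfb : f b = ‖b‖ ^ q) (hg : ‖g‖ ^ p ≤ S) (hgb : g b = S) :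
    ‖f - g‖ ^ p ≤ 2 ^ (p - 1) * (p - 1) * (‖b‖ ^ q - S) := by
  have midpoint : (‖b‖ ^ q + S) / 2 ≤ ‖f + g‖ ^ p / 2 ^ p / p + ‖b‖ ^ q / q := by
    have h := apply_le_norm_rpow_add_norm_rpow hpq ((2 : ℝ)⁻¹ • (f + g)) b
    rwa [smul_apply, add_apply, hfb, hgb, smul_eq_mul, inv_mul_eq_div,
      norm_smul_rpow_of_nonneg (inv_nonneg.2 zero_le_two), Real.inv_rpow zero_le_two,
      inv_mul_eq_div] at h
  have lower : 2 ^ p * (‖b‖ ^ q - p * (‖b‖ ^ q - S) / 2) ≤ ‖f + g‖ ^ p := by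
    have hp := hpq.pos
    rw [← le_div_iff₀' (by positivity)]
    have hq : ‖b‖ ^ q / q * p = (p - 1) * ‖b‖ ^ q := by
      rw [← hpq.div_conj_eq_sub_one]; ring
    have := mul_le_mul_of_nonneg_right midpoint hp.le
    rw [add_mul, div_mul_cancel₀ _ hp.ne', hq] at this
    linarith
  have two_rpow : (2 : ℝ) ^ p = 2 * 2 ^ (p - 1) := by
    rw [Real.rpow_sub_one two_ne_zero]; ring
  have upper : 2 ^ (p - 1) * (‖f‖ ^ p + ‖g‖ ^ p) ≤ 2 ^ (p - 1) * (‖b‖ ^ q + S) := by gcongr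
  rw [two_rpow] at lower
  linarith [hY f g]

theorem dense_of_forall_exists_apply_eq (hpq : p.HolderConjugate q)
    (hY : ClarksonWith (StrongDual ℝ Y) p (2 ^ (p - 1))) {s : Set (StrongDual ℝ Y)}
    (hs : ∀ b : Y, ∃ f ∈ s, ‖f‖ ^ p ≤ ‖b‖ ^ q ∧ f b = ‖b‖ ^ q) : Dense s := by
  refine Metric.dense_iff.2 fun g ε hε => ?_
  have hc : 0 < 2 ^ (p - 1) * (p - 1) := mul_pos (by positivity) hpq.sub_one_pos
  obtain ⟨b, hgb, hb⟩ := exists_apply_eq_norm_rpow hpq g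
    (div_pos (Real.rpow_pos_of_pos hε p) hc)
  obtain ⟨f, hfs, hf, hfb⟩ := hs b
  refine ⟨f, ?_, hfs⟩
  rw [Metric.mem_ball, dist_eq_norm, ← Real.rpow_lt_rpow_iff (norm_nonneg _) hε.le hpq.pos]
  calc ‖f - g‖ ^ p ≤ 2 ^ (p - 1) * (p - 1) * (‖b‖ ^ q - ‖g‖ ^ p) :=
        norm_sub_rpow_le_of_apply_eq hpq hY hf hfb le_rfl hgb
    _ < ε ^ p := by rw [← lt_div_iff₀' hc]; linarith

end Dual

section NearestPoint

variable {X : Type*} [NormedAddCommGroup X] [NormedSpace ℝ X]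

theorem ClarksonWith.norm_sub_rpow_le_of_convex {r : ℝ} (hr : 0 ≤ r)
    (hX : ClarksonWith X r (2 ^ (r - 1))) {s : Set X} (hs : Convex ℝ s) (x : X) {y z : X}
    (hy : y ∈ s) (hz : z ∈ s) :
    ‖y - z‖ ^ r ≤ 2 ^ (r - 1) * (‖x - y‖ ^ r + ‖x - z‖ ^ r - 2 * Metric.infDist x s ^ r) := by
  have hmid : Metric.infDist x s ≤ ‖x - midpoint ℝ y z‖ := by
    rw [← dist_eq_norm]
    exact Metric.infDist_le_dist_of_mem (hs.midpoint_mem hy hz)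
  have hadd : 2 ^ r * Metric.infDist x s ^ r ≤ ‖(x - y) + (x - z)‖ ^ r := by
    rw [← Real.mul_rpow zero_le_two Metric.infDist_nonneg]
    refine Real.rpow_le_rpow (mul_nonneg zero_le_two Metric.infDist_nonneg) ?_ hr
    calc 2 * Metric.infDist x s ≤ 2 * ‖x - midpoint ℝ y z‖ := by gcongr
      _ = ‖(x - y) + (x - z)‖ := by
        rw [← Real.norm_of_nonneg (zero_le_two (α := ℝ)), ← norm_smul, midpoint_eq_smul_add,
          smul_sub, smul_smul, invOf_eq_inv, mul_inv_cancel₀ two_ne_zero, one_smul, two_smul]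
        abel_nf
  have two_rpow : (2 : ℝ) ^ r = 2 * 2 ^ (r - 1) := by
    rw [Real.rpow_sub_one two_ne_zero]; ring
  have h := hX (x - y) (x - z)
  rw [sub_sub_sub_cancel_left, norm_sub_rev z y] at h
  rw [two_rpow] at hadd
  linarith

theorem ClarksonWith.exists_norm_sub_eq_infDist {r : ℝ} (hr : 0 < r)
    (hX : ClarksonWith X r (2 ^ (r - 1))) {s : Set X} (hs : Convex ℝ s) (hcs : IsComplete s)
    (hne : s.Nonempty) (x : X) : ∃ y ∈ s, ‖x - y‖ = Metric.infDist x s := by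
  set δ := Metric.infDist x s
  obtain ⟨y, hy, hlim⟩ : ∃ y : ℕ → X, (∀ n, y n ∈ s) ∧
      Tendsto (fun n => ‖x - y n‖) atTop (𝓝 δ) := by
    obtain ⟨u, -, -, hu, hus⟩ :=
      (Metric.isGLB_infDist (x := x) hne).exists_seq_antitone_tendsto (hne.image _)
    choose y hy hyu using hus
    exact ⟨y, hy, by simpa only [← dist_eq_norm, hyu] using hu⟩
  have hbound : Tendsto (fun n : ℕ × ℕ =>
      (2 ^ (r - 1) * (‖x - y n.1‖ ^ r + ‖x - y n.2‖ ^ r - 2 * δ ^ r)) ^ r⁻¹) atTop (𝓝 0) := by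
    have h := hlim.rpow_const (p := r) (.inr hr.le)
    rw [← prod_atTop_atTop_eq]
    have h' := ((((h.comp tendsto_fst).add (h.comp tendsto_snd)).sub_const
      (2 * δ ^ r)).const_mul (2 ^ (r - 1))).rpow_const (p := r⁻¹) (.inr (inv_nonneg.2 hr.le))
    rwa [← two_mul, sub_self, mul_zero, Real.zero_rpow (inv_ne_zero hr.ne')] at h'
  have hcauchy : CauchySeq y := by
    refine cauchySeq_iff_tendsto_dist_atTop_0.2 (squeeze_zero (fun _ => dist_nonneg) (fun n => ?_)
      hbound)
    rw [dist_eq_norm, Real.le_rpow_inv_iff_of_pos (norm_nonneg _) _ hr]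
    exacts [hX.norm_sub_rpow_le_of_convex hr.le hs x (hy _) (hy _),
      (by positivity : (0 : ℝ) ≤ _).trans (hX.norm_sub_rpow_le_of_convex hr.le hs x (hy _) (hy _))]
  obtain ⟨z, hz, hyz⟩ := cauchySeq_tendsto_of_isComplete hcs hy hcauchy
  exact ⟨z, hz, tendsto_nhds_unique (tendsto_const_nhds.sub hyz).norm hlim⟩

end NearestPoint

section HahnBanach

variable {X Y : Type*} [NormedAddCommGroup X] [NormedSpace ℝ X] [NormedAddCommGroup Y]
  [NormedSpace ℝ Y]

theorem exists_strongDual_comp_eq {V : Type*} [AddCommGroup V] [Module ℝ V] (ℓ : V →ₗ[ℝ] ℝ)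
    (T : V →ₗ[ℝ] Y) {C : ℝ} (hC : 0 ≤ C) (h : ∀ v, |ℓ v| ≤ C * ‖T v‖) :
    ∃ g : StrongDual ℝ Y, ‖g‖ ≤ C ∧ ∀ v, g (T v) = ℓ v := by
  have hker : T.rangeRestrict.ker ≤ ℓ.ker := fun v hv => by
    have hTv : T v = 0 := by simpa using hv
    simpa [hTv] using h v
  obtain ⟨m, hm⟩ : ℓ ∈ T.rangeRestrict.dualMap.range := by
    rw [LinearMap.range_dualMap_eq_dualAnnihilator_ker]
    exact (Submodule.mem_dualAnnihilator ℓ).2 hker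
  have hmT (v : V) : m (T.rangeRestrict v) = ℓ v := LinearMap.congr_fun hm v
  have hbound (w : T.range) : ‖m w‖ ≤ C * ‖w‖ := by
    obtain ⟨v, rfl⟩ := T.surjective_rangeRestrict w
    rw [hmT]
    exact h v
  obtain ⟨g, hg, hnorm⟩ := exists_extension_norm_eq T.range (m.mkContinuous C hbound)
  exact ⟨g, hnorm.trans_le (m.mkContinuous_norm_le hC hbound),
    fun v => (hg (T.rangeRestrict v)).trans (hmT v)⟩

theorem abs_apply_le_infDist {φ : StrongDual ℝ X} (hφ : ‖φ‖ ≤ 1) {K : Submodule ℝ X}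
    (hK : ∀ k ∈ K, φ k = 0) (x : X) : |φ x| ≤ Metric.infDist x K := by
  refine (Metric.le_infDist K.nonempty).2 fun k hk => ?_
  calc |φ x| = ‖φ (x - k)‖ := by rw [map_sub, hK k hk, sub_zero, Real.norm_eq_abs]
    _ ≤ 1 * ‖x - k‖ := φ.le_of_opNorm_le hφ _
    _ = dist x k := by rw [one_mul, dist_eq_norm]

variable {p q : ℝ}

theorem exists_strongDual_norm_rpow_le_of_sobolev (hpq : p.HolderConjugate q)
    {Γ : Submodule ℝ (X × Y)} {K : Submodule ℝ X} {S : ℝ} (hS : 0 ≤ S)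
    (hsob : ∀ d ∈ Γ, S * Metric.infDist d.1 K ^ q ≤ ‖d.2‖ ^ q)
    {φ : StrongDual ℝ X} (hφ : ‖φ‖ ≤ 1) (hK : ∀ k ∈ K, φ k = 0) :
    ∃ g : StrongDual ℝ Y, ‖g‖ ^ p ≤ S ∧ ∀ d ∈ Γ, g d.2 = S * φ d.1 := by
  have hbound (d : Γ) : |S * φ d.1.1| ≤ S ^ p⁻¹ * ‖d.1.2‖ := by
    have hroot : S ^ q⁻¹ * Metric.infDist d.1.1 K ≤ ‖d.1.2‖ := by
      have hq := hpq.symm.pos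
      rw [← Real.rpow_le_rpow_iff (mul_nonneg (by positivity) Metric.infDist_nonneg)
        (norm_nonneg _) hq, Real.mul_rpow (by positivity) Metric.infDist_nonneg,
        Real.rpow_inv_rpow hS hq.ne']
      exact hsob d d.2
    calc |S * φ d.1.1| = S * |φ d.1.1| := by rw [abs_mul, abs_of_nonneg hS]
      _ ≤ S * Metric.infDist d.1.1 K := by gcongr; exact abs_apply_le_infDist hφ hK _
      _ = S ^ p⁻¹ * (S ^ q⁻¹ * Metric.infDist d.1.1 K) := by
        rw [← mul_assoc, ← Real.rpow_add_of_nonneg hS hpq.inv_nonneg hpq.symm.inv_nonneg,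
          hpq.inv_add_inv_eq_one, Real.rpow_one]
      _ ≤ S ^ p⁻¹ * ‖d.1.2‖ := by gcongr
  obtain ⟨g, hg, hgΓ⟩ := exists_strongDual_comp_eq
    ((S • (φ : X →ₗ[ℝ] ℝ) ∘ₗ LinearMap.fst ℝ X Y) ∘ₗ Γ.subtype)
    (LinearMap.snd ℝ X Y ∘ₗ Γ.subtype) (Real.rpow_nonneg hS p⁻¹) hbound
  exact ⟨g, (Real.le_rpow_inv_iff_of_pos (norm_nonneg _) hS hpq.pos).1 hg,
    fun d hd => hgΓ ⟨d, hd⟩⟩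

end HahnBanach

section DualityMap

variable {E : Type*} [NormedAddCommGroup E] [InnerProductSpace ℝ E]

/-- The duality map `x ↦ |x|^(r-2) x`, which is the gradient of `|x|^r / r`. For `r < 2` the factor
`0 ^ (r - 2)` at the origin is harmless, as it multiplies `x = 0`. -/
def dualityMap (r : ℝ) (x : E) : E :=
  ‖x‖ ^ (r - 2) • x

theorem norm_dualityMap {r : ℝ} (hr : r ≠ 1) (x : E) : ‖dualityMap r x‖ = ‖x‖ ^ (r - 1) := by
  rcases eq_or_ne x 0 with rfl | hx
  · simp [dualityMap, Real.zero_rpow (sub_ne_zero.2 hr)]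
  · rw [dualityMap, norm_smul, Real.norm_of_nonneg (by positivity),
      ← Real.rpow_add_one (norm_ne_zero_iff.2 hx)]
    ring_nf

theorem norm_dualityMap_rpow {p q : ℝ} (hpq : p.HolderConjugate q) (x : E) :
    ‖dualityMap p x‖ ^ q = ‖x‖ ^ p := by
  rw [norm_dualityMap hpq.lt.ne', ← Real.rpow_mul (norm_nonneg x), hpq.sub_one_mul_conj]

theorem inner_dualityMap_self {r : ℝ} (hr : r ≠ 0) (x : E) :
    inner ℝ (dualityMap r x) x = ‖x‖ ^ r := by
  rcases eq_or_ne x 0 with rfl | hx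
  · simp [Real.zero_rpow hr]
  · rw [dualityMap, real_inner_smul_left, real_inner_self_eq_norm_sq, ← Real.rpow_natCast,
      ← Real.rpow_add (norm_pos_iff.2 hx)]
    norm_num

theorem hasDerivAt_norm_add_smul_rpow {p : ℝ} (hp : 1 < p) (x y : E) (t : ℝ) :
    HasDerivAt (fun s : ℝ => ‖x + s • y‖ ^ p) (p * inner ℝ (dualityMap p (x + t • y)) y) t := by
  have hline : HasDerivAt (fun s : ℝ => x + s • y) y t := by
    simpa using ((hasDerivAt_id t).smul_const y).const_add x
  have h := (hasFDerivAt_norm_rpow (x + t • y) hp).comp_hasDerivAt t hline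
  rw [smul_apply, innerSL_apply_apply, smul_eq_mul, mul_assoc] at h
  rwa [dualityMap, real_inner_smul_left]

theorem abs_inner_dualityMap_add_smul_le {p : ℝ} (hp : 1 < p) (x y : E) {t : ℝ} (ht : |t| ≤ 1) :
    |inner ℝ (dualityMap p (x + t • y)) y| ≤ (‖x‖ + ‖y‖) ^ p := by
  have hnorm : ‖x + t • y‖ ≤ ‖x‖ + ‖y‖ :=
    (norm_add_le _ _).trans (by
      rw [norm_smul]; gcongr; exact mul_le_of_le_one_left (norm_nonneg y) ht)
  calc |inner ℝ (dualityMap p (x + t • y)) y|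
      ≤ ‖x + t • y‖ ^ (p - 1) * ‖y‖ := by
        rw [← norm_dualityMap hp.ne']; exact abs_real_inner_le_norm _ _
    _ ≤ (‖x‖ + ‖y‖) ^ (p - 1) * (‖x‖ + ‖y‖) := by
        gcongr
        exact le_add_of_nonneg_left (norm_nonneg x)
    _ = (‖x‖ + ‖y‖) ^ p := by
        rw [← Real.rpow_add_one' (by positivity) (by linarith), sub_add_cancel]

theorem dualityMap_three (x : E) : dualityMap 3 x = ‖x‖ • x := by
  norm_num [dualityMap]

theorem dualityMap_three_halves (x : E) :
    dualityMap (3 / 2) x = ‖x‖ ^ (-(1 / 2) : ℝ) • x := by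
  norm_num [dualityMap]

end DualityMap

section LpNorm

variable {α E : Type*} [MeasurableSpace α] {μ : Measure α} [NormedAddCommGroup E]
  {p : ℝ≥0∞}

theorem lpNorm_eq_norm_toLp {f : α → E} (hf : MemLp f p μ) :
    lpNorm f p μ = ‖hf.toLp f‖ := by
  rw [Lp.norm_toLp, toReal_eLpNorm hf.1]

theorem tendsto_eLpNorm_zero_of_lpNorm_rpow_le {s : ℝ} (hs : 0 < s)
    {ι : Type*} {l : Filter ι}
    {r : ι → α → E} (hr : ∀ n, MemLp (r n) p μ) {c : ι → ℝ}
    (hc : Tendsto c l (𝓝 0)) (hrc : ∀ n, lpNorm (r n) p μ ^ s ≤ c n) :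
    Tendsto (fun n => eLpNorm (r n) p μ) l (𝓝 0) := by
  have hpow : Tendsto (fun n => lpNorm (r n) p μ ^ s) l (𝓝 0) :=
    squeeze_zero (fun n => Real.rpow_nonneg lpNorm_nonneg s) hrc hc
  have hnorm : Tendsto (fun n => lpNorm (r n) p μ) l (𝓝 0) := by
    have h := hpow.rpow_const (p := s⁻¹) (Or.inr (inv_nonneg.2 hs.le))
    simpa only [Real.rpow_rpow_inv lpNorm_nonneg hs.ne', Real.zero_rpow (inv_ne_zero hs.ne')]
      using h
  simpa only [ofReal_lpNorm (hr _), ENNReal.ofReal_zero] using ENNReal.tendsto_ofReal hnorm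

theorem coeFn_add_smul_lp [NormedSpace ℝ E] (f g : Lp E p μ) (t : ℝ) :
    ⇑(f + t • g) =ᵐ[μ] fun x => f x + t • g x := by
  filter_upwards [Lp.coeFn_add f (t • g), Lp.coeFn_smul t g] with x hadd hsmul
  rw [hadd, Pi.add_apply, hsmul, Pi.smul_apply]

variable [Fact (1 ≤ p)]

theorem norm_rpow_eq_integral (hp : p ≠ ⊤) (f : Lp E p μ) :
    ‖f‖ ^ p.toReal = ∫ x, ‖f x‖ ^ p.toReal ∂μ := by
  have hp0 : p ≠ 0 := (zero_lt_one.trans_le (Fact.out : 1 ≤ p)).ne'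
  rw [Lp.norm_def, toReal_eLpNorm (Lp.aestronglyMeasurable f),
    lpNorm_eq_integral_norm_rpow_toReal hp0 hp (Lp.aestronglyMeasurable f),
    Real.rpow_inv_rpow (by positivity) (ENNReal.toReal_ne_zero.2 ⟨hp0, hp⟩)]

theorem integrable_norm_rpow_lp (hp : p ≠ ⊤) (f : Lp E p μ) :
    Integrable (fun x => ‖f x‖ ^ p.toReal) μ :=
  (Lp.memLp f).integrable_norm_rpow (zero_lt_one.trans_le (Fact.out : 1 ≤ p)).ne' hp

theorem norm_add_smul_rpow_eq_integral [NormedSpace ℝ E] (hp : p ≠ ⊤) (f g : Lp E p μ) (t : ℝ) :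
    ‖f + t • g‖ ^ p.toReal = ∫ x, ‖f x + t • g x‖ ^ p.toReal ∂μ := by
  rw [norm_rpow_eq_integral hp]
  exact integral_congr_ae ((coeFn_add_smul_lp f g t).mono fun x hx => by simp only [hx])

theorem ClarksonWith.lp (hp : p ≠ ⊤) {C : ℝ} (hE : ClarksonWith E p.toReal C) :
    ClarksonWith (Lp E p μ) p.toReal C := by
  intro f g
  simp only [norm_rpow_eq_integral hp]
  rw [← integral_add (integrable_norm_rpow_lp hp _) (integrable_norm_rpow_lp hp _),
    ← integral_add (integrable_norm_rpow_lp hp _) (integrable_norm_rpow_lp hp _),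
    ← integral_const_mul]
  refine integral_mono_ae
    ((integrable_norm_rpow_lp hp _).add (integrable_norm_rpow_lp hp _))
    (((integrable_norm_rpow_lp hp _).add (integrable_norm_rpow_lp hp _)).const_mul C) ?_
  filter_upwards [Lp.coeFn_add f g, Lp.coeFn_sub f g] with x hadd hsub
  rw [hadd, hsub]
  exact hE (f x) (g x)

end LpNorm

section LpDuality

variable {α E : Type*} [MeasurableSpace α] {μ : Measure α} [NormedAddCommGroup E]
  [InnerProductSpace ℝ E] {p q : ℝ≥0∞} [p.HolderConjugate q]

theorem memLp_dualityMap (hp : 1 < p.toReal) {f : α → E} (hf : MemLp f p μ) :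
    MemLp (fun x => dualityMap p.toReal (f x)) q μ := by
  have hpq := ENNReal.HolderConjugate.toReal (q := q) hp
  have hp' := ENNReal.toReal_ne_zero.1 hpq.ne_zero
  have hq' := ENNReal.toReal_ne_zero.1 hpq.symm.ne_zero
  have hmeas : AEStronglyMeasurable (fun x => dualityMap p.toReal (f x)) μ :=
    (hf.1.norm.aemeasurable.pow_const _).aestronglyMeasurable.smul hf.1
  rw [← integrable_norm_rpow_iff hmeas hq'.1 hq'.2]
  simpa only [norm_dualityMap_rpow hpq] using hf.integrable_norm_rpow hp'.1 hp'.2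

/-- The duality map of `L^p`, with values in the conjugate `L^q`. -/
def lpDuality (hp : 1 < p.toReal) (f : Lp E p μ) : Lp E q μ :=
  (memLp_dualityMap hp (Lp.memLp f)).toLp

theorem coeFn_lpDuality (hp : 1 < p.toReal) (f : Lp E p μ) :
    (lpDuality hp f : Lp E q μ) =ᵐ[μ] fun x => dualityMap p.toReal (f x) :=
  MemLp.coeFn_toLp _

variable [Fact (1 ≤ p)] [Fact (1 ≤ q)]

theorem norm_lpDuality_rpow (hp : 1 < p.toReal) (f : Lp E p μ) :
    ‖(lpDuality hp f : Lp E q μ)‖ ^ q.toReal = ‖f‖ ^ p.toReal := by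
  have hpq := ENNReal.HolderConjugate.toReal (q := q) hp
  rw [norm_rpow_eq_integral (ENNReal.toReal_ne_zero.1 hpq.ne_zero).2,
    norm_rpow_eq_integral (ENNReal.toReal_ne_zero.1 hpq.symm.ne_zero).2]
  refine integral_congr_ae ?_
  filter_upwards [coeFn_lpDuality (q := q) hp f] with x hx
  rw [hx, norm_dualityMap_rpow hpq]

/-- The pairing `(f, g) ↦ ∫ ⟪f, g⟫` of `L^p` and `L^q`, as a map of `L^p` into the dual of `L^q`. -/
def lpToDual : Lp E p μ →L[ℝ] StrongDual ℝ (Lp E q μ) :=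
  (innerSL ℝ).lpPairing μ p q

theorem lpToDual_apply (f : Lp E p μ) (g : Lp E q μ) :
    lpToDual f g = ∫ x, inner ℝ (f x) (g x) ∂μ :=
  (innerSL ℝ).lpPairing_eq_integral f g

theorem lpToDual_toLp (f : Lp E p μ) {g : α → E} (hg : MemLp g q μ) :
    lpToDual f hg.toLp = ∫ x, inner ℝ (f x) (g x) ∂μ := by
  rw [lpToDual_apply]
  exact integral_congr_ae (hg.coeFn_toLp.mono fun x hx => by simp only [hx])

theorem lpToDual_comm (f : Lp E p μ) (g : Lp E q μ) : lpToDual f g = lpToDual g f := by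
  simp only [lpToDual_apply, real_inner_comm]

theorem lpToDual_toLp_left {f : α → E} (hf : MemLp f p μ) (g : Lp E q μ) :
    lpToDual hf.toLp g = ∫ x, inner ℝ (g x) (f x) ∂μ := by
  rw [lpToDual_comm, lpToDual_toLp]

theorem lpToDual_lpDuality_self (hp : 1 < p.toReal) (f : Lp E p μ) :
    lpToDual (lpDuality hp f : Lp E q μ) f = ‖f‖ ^ p.toReal := by
  have hp0 : p.toReal ≠ 0 := (zero_lt_one.trans hp).ne'
  rw [lpToDual_apply, norm_rpow_eq_integral (ENNReal.toReal_ne_zero.1 hp0).2]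
  refine integral_congr_ae ?_
  filter_upwards [coeFn_lpDuality (q := q) hp f] with x hx
  rw [hx, inner_dualityMap_self hp0]

theorem norm_lpToDual_le (f : Lp E p μ) : ‖(lpToDual f : StrongDual ℝ (Lp E q μ))‖ ≤ ‖f‖ := by
  refine ContinuousLinearMap.opNorm_le_bound _ (norm_nonneg f) fun g => ?_
  have hint : lpToDual f g = ∫ x, (innerSL ℝ).holder 1 f g x ∂μ := by
    rw [lpToDual_apply]
    exact (integral_congr_ae ((innerSL ℝ).coeFn_holder (r := 1) f g)).symm
  calc ‖lpToDual f g‖ ≤ ‖(innerSL ℝ).holder 1 f g‖ := by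
        rw [hint, L1.norm_eq_integral_norm]; exact norm_integral_le_integral_norm _
    _ ≤ ‖innerSL ℝ (E := E)‖ * ‖f‖ * ‖g‖ :=
        ContinuousLinearMap.norm_holder_apply_apply_le _ _ _
    _ ≤ 1 * ‖f‖ * ‖g‖ := by gcongr; exact norm_innerSL_le ℝ
    _ = ‖f‖ * ‖g‖ := by rw [one_mul]

theorem norm_lpToDual (hp : 1 < p.toReal) (f : Lp E p μ) :
    ‖(lpToDual f : StrongDual ℝ (Lp E q μ))‖ = ‖f‖ := by
  refine (norm_lpToDual_le f).antisymm ?_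
  have hpq := ENNReal.HolderConjugate.toReal (q := q) hp
  rcases (norm_nonneg f).eq_or_lt with hf | hf
  · rw [← hf]; positivity
  have hJ : ‖(lpDuality hp f : Lp E q μ)‖ = ‖f‖ ^ (p.toReal - 1) := by
    rw [← Real.rpow_left_inj (norm_nonneg _) (by positivity) hpq.symm.ne_zero,
      norm_lpDuality_rpow, ← Real.rpow_mul hf.le, hpq.sub_one_mul_conj]
  refine le_of_mul_le_mul_right ?_ (Real.rpow_pos_of_pos hf (p.toReal - 1))
  calc ‖f‖ * ‖f‖ ^ (p.toReal - 1) = lpToDual f (lpDuality hp f : Lp E q μ) := by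
        rw [lpToDual_comm, lpToDual_lpDuality_self, mul_comm, ← Real.rpow_add_one hf.ne',
          sub_add_cancel]
    _ ≤ ‖(lpToDual f : StrongDual ℝ (Lp E q μ))‖ * ‖f‖ ^ (p.toReal - 1) := by
        rw [← hJ]; exact (Real.le_norm_self _).trans (ContinuousLinearMap.le_opNorm _ _)

theorem isometry_lpToDual (hp : 1 < p.toReal) :
    Isometry (lpToDual : Lp E p μ → StrongDual ℝ (Lp E q μ)) :=
  Isometry.of_dist_eq fun f g => by
    rw [dist_eq_norm, ← map_sub, norm_lpToDual hp, dist_eq_norm]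

theorem norm_lpToDual_lpDuality_rpow (hp : 1 < p.toReal) (f : Lp E p μ) :
    ‖(lpToDual (lpDuality hp f : Lp E q μ) : StrongDual ℝ (Lp E p μ))‖ ^ q.toReal =
      ‖f‖ ^ p.toReal := by
  rw [norm_lpToDual (ENNReal.HolderConjugate.toReal (q := q) hp).symm.lt, norm_lpDuality_rpow]

theorem clarksonWith_lp (hp : 2 ≤ p.toReal) :
    ClarksonWith (Lp E p μ) p.toReal (2 ^ (p.toReal - 1)) :=
  (clarksonWith_of_inner hp).lp (ENNReal.toReal_ne_zero.1 (by linarith)).2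

theorem clarksonWith_lp_conj (hp : 2 ≤ p.toReal) :
    ClarksonWith (Lp E q μ) q.toReal 2 := by
  have hpq := ENNReal.HolderConjugate.toReal (q := q) (one_lt_two.trans_le hp)
  have hconst : ((2 : ℝ) ^ (p.toReal - 1)) ^ (q.toReal - 1) = 2 := by
    rw [← Real.rpow_mul zero_le_two, mul_sub_one, hpq.sub_one_mul_conj, sub_sub_cancel,
      Real.rpow_one]
  rw [← hconst]
  exact ((clarksonWith_lp hp).strongDual hpq.symm (by positivity)).of_isometry
    (lpToDual : Lp E q μ →L[ℝ] StrongDual ℝ (Lp E p μ)).toLinearMap.toAddMonoidHom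
    (norm_lpToDual hpq.symm.lt)

theorem clarksonWith_strongDual_lp (hp : 2 ≤ p.toReal) :
    ClarksonWith (StrongDual ℝ (Lp E q μ)) p.toReal (2 ^ (p.toReal - 1)) :=
  (clarksonWith_lp_conj hp).strongDual
    (ENNReal.HolderConjugate.toReal (one_lt_two.trans_le hp)) two_pos

theorem lpToDual_surjective [CompleteSpace E] (hp : 2 ≤ p.toReal) :
    Function.Surjective (lpToDual : Lp E p μ → StrongDual ℝ (Lp E q μ)) := by
  have hpq := ENNReal.HolderConjugate.toReal (q := q) (one_lt_two.trans_le hp)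
  have hiso : Isometry (lpToDual : Lp E p μ → StrongDual ℝ (Lp E q μ)) :=
    isometry_lpToDual hpq.lt
  have hclosed : IsClosed (Set.range (lpToDual : Lp E p μ → StrongDual ℝ (Lp E q μ))) :=
    hiso.isClosedEmbedding.isClosed_range
  have hdense : Dense (Set.range (lpToDual : Lp E p μ → StrongDual ℝ (Lp E q μ))) :=
    dense_of_forall_exists_apply_eq hpq (clarksonWith_strongDual_lp hp) fun b =>
      ⟨_, Set.mem_range_self (lpDuality hpq.symm.lt b), (norm_lpToDual_lpDuality_rpow _ b).le,
        lpToDual_lpDuality_self _ b⟩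
  exact Set.range_eq_univ.1 (hclosed.closure_eq ▸ hdense.closure_eq)

theorem hasDerivAt_norm_add_smul_rpow_lp (hp : 1 < p.toReal) (f g : Lp E p μ) :
    HasDerivAt (fun t : ℝ => ‖f + t • g‖ ^ p.toReal)
      (p.toReal * lpToDual (lpDuality hp f : Lp E q μ) g) 0 := by
  have hp0 : 0 < p.toReal := zero_lt_one.trans hp
  have hp' := ENNReal.toReal_ne_zero.1 hp0.ne'
  have hderiv : p.toReal * lpToDual (lpDuality hp f : Lp E q μ) g =
      ∫ x, p.toReal * inner ℝ (dualityMap p.toReal (f x + (0 : ℝ) • g x)) (g x) ∂μ := by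
    rw [lpToDual_apply, ← integral_const_mul]
    refine integral_congr_ae ?_
    filter_upwards [coeFn_lpDuality (q := q) hp f] with x hx
    rw [hx, zero_smul, add_zero]
  have hmeas (t : ℝ) : AEStronglyMeasurable (fun x => f x + t • g x) μ :=
    (Lp.aestronglyMeasurable f).add ((Lp.aestronglyMeasurable g).const_smul t)
  have hint (t : ℝ) : Integrable (fun x => ‖f x + t • g x‖ ^ p.toReal) μ :=
    (integrable_norm_rpow_lp hp'.2 (f + t • g)).congr
      ((coeFn_add_smul_lp f g t).fun_comp (‖·‖ ^ p.toReal))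
  simp only [norm_add_smul_rpow_eq_integral hp'.2]
  rw [hderiv]
  refine (hasDerivAt_integral_of_dominated_loc_of_deriv_le (Metric.ball_mem_nhds 0 one_pos)
    (Eventually.of_forall fun t => (hint t).1) (hint 0) ?_
    (bound := fun x => p.toReal * (‖f x‖ + ‖g x‖) ^ p.toReal)
    (Eventually.of_forall fun x t ht => ?_) ?_
    (Eventually.of_forall fun x t _ => hasDerivAt_norm_add_smul_rpow hp (f x) (g x) t)).2
  · have h := (hmeas 0).norm.aemeasurable.pow_const (p.toReal - 2)
    exact ((h.aestronglyMeasurable.smul (hmeas 0)).inner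
      (Lp.aestronglyMeasurable g)).const_mul p.toReal
  · rw [norm_mul, Real.norm_of_nonneg hp0.le]
    gcongr
    exact abs_inner_dualityMap_add_smul_le hp _ _ (by simpa using (mem_ball_zero_iff.1 ht).le)
  · have h := ((Lp.memLp f).norm.add (Lp.memLp g).norm).integrable_norm_rpow hp'.1 hp'.2
    refine (h.congr (Eventually.of_forall fun x => ?_)).const_mul p.toReal
    simp only [Pi.add_apply, Real.norm_of_nonneg (add_nonneg (norm_nonneg (f x))
      (norm_nonneg (g x)))]

theorem lpToDual_lpDuality_eq_zero (hp : 1 < p.toReal) {f g : Lp E p μ}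
    (h : ∀ t : ℝ, ‖f‖ ≤ ‖f + t • g‖) : lpToDual (lpDuality hp f : Lp E q μ) g = 0 := by
  have hp0 : 0 < p.toReal := zero_lt_one.trans hp
  have hmin : IsLocalMin (fun t : ℝ => ‖f + t • g‖ ^ p.toReal) 0 :=
    Eventually.of_forall fun t => by
      simpa using Real.rpow_le_rpow (norm_nonneg f) (h t) hp0.le
  have hzero := hmin.hasDerivAt_eq_zero (hasDerivAt_norm_add_smul_rpow_lp (q := q) hp f g)
  exact (mul_eq_zero.1 hzero).resolve_left hp0.ne'

theorem exists_sub_mem_forall_lpToDual_lpDuality_eq_zero [CompleteSpace E] (hp : 2 ≤ p.toReal)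
    {K : Submodule ℝ (Lp E p μ)} (hK : IsClosed (K : Set (Lp E p μ))) (a : Lp E p μ) :
    ∃ v, a - v ∈ K ∧ ‖v‖ = Metric.infDist a K ∧
      ∀ k ∈ K, lpToDual (lpDuality (one_lt_two.trans_le hp) v : Lp E q μ) k = 0 := by
  obtain ⟨y, hy, hmin⟩ := (clarksonWith_lp hp).exists_norm_sub_eq_infDist (by linarith)
    K.convex hK.isComplete K.nonempty a
  refine ⟨a - y, by rwa [sub_sub_cancel], hmin, fun k hk =>
    lpToDual_lpDuality_eq_zero _ fun t => ?_⟩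
  rw [hmin, sub_add, ← dist_eq_norm]
  exact Metric.infDist_le_dist_of_mem (K.sub_mem hy (K.smul_mem t hk))

theorem exists_norm_rpow_le_of_sobolev [CompleteSpace E] (hp : 2 ≤ p.toReal)
    {Γ : Submodule ℝ (Lp E p μ × Lp E q μ)} {K : Submodule ℝ (Lp E p μ)} {S : ℝ} (hS : 0 ≤ S)
    (hsob : ∀ d ∈ Γ, S * Metric.infDist d.1 K ^ q.toReal ≤ ‖d.2‖ ^ q.toReal)
    (hq : 1 < q.toReal) {v : Lp E p μ} {b : Lp E q μ} (hvb : (v, b) ∈ Γ) (hv : ‖v‖ = 1)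
    (hK : ∀ k ∈ K, lpToDual (lpDuality (one_lt_two.trans_le hp) v : Lp E q μ) k = 0) :
    ∃ r : Lp E p μ,
      ‖r‖ ^ p.toReal ≤ 2 ^ (p.toReal - 1) * (p.toReal - 1) * (‖b‖ ^ q.toReal - S) ∧
      ∀ d ∈ Γ, lpToDual (lpDuality hq b : Lp E p μ) d.2 -
        S * lpToDual (lpDuality (one_lt_two.trans_le hp) v : Lp E q μ) d.1 = lpToDual r d.2 := by
  have hpq := ENNReal.HolderConjugate.toReal (q := q) (one_lt_two.trans_le hp)
  have hφ : ‖(lpToDual (lpDuality (one_lt_two.trans_le hp) v : Lp E q μ) :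
      StrongDual ℝ (Lp E p μ))‖ ≤ 1 := by
    refine (Real.rpow_le_rpow_iff (by positivity) zero_le_one hpq.symm.pos).1 ?_
    rw [norm_lpToDual_lpDuality_rpow, hv, Real.one_rpow, Real.one_rpow]
  obtain ⟨g, hg, hgΓ⟩ := exists_strongDual_norm_rpow_le_of_sobolev hpq hS hsob hφ hK
  obtain ⟨r, hr⟩ := lpToDual_surjective (q := q) hp (lpToDual (lpDuality hq b : Lp E p μ) - g)
  have hgb : g b = S := by
    rw [hgΓ _ hvb, lpToDual_lpDuality_self, hv, Real.one_rpow, mul_one]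
  refine ⟨r, ?_, fun d hd => by rw [hr, sub_apply, hgΓ d hd]⟩
  rw [← norm_lpToDual (q := q) hpq.lt, hr]
  exact norm_sub_rpow_le_of_apply_eq hpq (clarksonWith_strongDual_lp hp)
    (norm_lpToDual_lpDuality_rpow hq b).le (lpToDual_lpDuality_self hq b) hg hgb

end LpDuality

namespace CurlSobolev

section TestFunctions

variable {F G W : Type*} [NormedAddCommGroup F] [NormedSpace ℝ F] [NormedAddCommGroup G]
  [NormedSpace ℝ G] [NormedAddCommGroup W] [NormedSpace ℝ W]

theorem IsTest.memLp {f : E3 → F} (hf : IsTest f) (p : ℝ≥0∞) : MemLp f p :=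
  hf.1.continuous.memLp_of_hasCompactSupport hf.2

theorem IsTest.integrable {f : E3 → F} (hf : IsTest f) : Integrable f :=
  hf.1.continuous.integrable_of_hasCompactSupport hf.2

theorem IsTest.differentiable {f : E3 → F} (hf : IsTest f) : Differentiable ℝ f :=
  hf.1.differentiable (by simp)

theorem IsTest.clm_comp {f : E3 → F} (hf : IsTest f) (L : F →L[ℝ] G) : IsTest fun x => L (f x) :=
  ⟨L.contDiff.comp hf.1, hf.2.comp_left (map_zero L)⟩

theorem IsTest.isTest_fderiv {f : E3 → F} (hf : IsTest f) : IsTest (fderiv ℝ f) :=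
  ⟨hf.1.fderiv_right (by simp), hf.2.fderiv ℝ⟩

theorem IsTest.isTest_fderiv_apply {f : E3 → F} (hf : IsTest f) (v : E3) :
    IsTest fun x => fderiv ℝ f x v :=
  hf.isTest_fderiv.clm_comp (ContinuousLinearMap.apply ℝ F v)

theorem IsTest.isTest_gradient {f : E3 → ℝ} (hf : IsTest f) : IsTest (gradient f) :=
  let L := (InnerProductSpace.toDual ℝ E3).symm.toContinuousLinearEquiv
  ⟨L.contDiff.comp hf.isTest_fderiv.1, hf.isTest_fderiv.2.comp_left (map_zero L)⟩

theorem IsTest.bilin {f : E3 → F} {g : E3 → G} (hf : IsTest f) (hg : IsTest g)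
    (B : F →L[ℝ] G →L[ℝ] W) : IsTest fun x => B (f x) (g x) :=
  ⟨(hf.clm_comp B).1.clm_apply hg.1, hf.2.mono fun x hx h => hx (by simp [h])⟩

theorem IsTest.isTest_inner {E : Type*} [NormedAddCommGroup E] [InnerProductSpace ℝ E]
    {f g : E3 → E} (hf : IsTest f) (hg : IsTest g) : IsTest fun x => inner ℝ (f x) (g x) :=
  hf.bilin hg (innerSL ℝ)

theorem IsTest.integral_bilin_fderiv_apply {f : E3 → F} {g : E3 → G} (hf : IsTest f)
    (hg : IsTest g) (B : F →L[ℝ] G →L[ℝ] W) (v : E3) :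
    ∫ x, B (f x) (fderiv ℝ g x v) = -∫ x, B (fderiv ℝ f x v) (g x) :=
  integral_bilinear_fderiv_right_eq_neg_left_of_integrable
    ((hf.isTest_fderiv_apply v).bilin hg B).integrable
    (hf.bilin (hg.isTest_fderiv_apply v) B).integrable (hf.bilin hg B).integrable
    (fun x _ => hf.differentiable x) fun x _ => hg.differentiable x

theorem IsTest.fderiv_fderiv_comm {f : E3 → F} (hf : IsTest f) (v w x : E3) :
    fderiv ℝ (fun y => fderiv ℝ f y v) x w =
      fderiv ℝ (fun y => fderiv ℝ f y w) x v := by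
  have hsymm : IsSymmSndFDerivAt ℝ f x := hf.1.contDiffAt.isSymmSndFDerivAt (by
    rw [minSmoothness_of_isRCLikeNormedField]
    exact WithTop.coe_le_coe.2 (le_top (a := (2 : ℕ∞))))
  have hderiv (u : E3) : fderiv ℝ (fun y => fderiv ℝ f y u) x =
      (fderiv ℝ (fderiv ℝ f) x).flip u := by
    simpa using fderiv_clm_apply (hf.isTest_fderiv.differentiable x) (differentiableAt_const u)
  rw [hderiv, hderiv]
  exact hsymm.eq w v

end TestFunctions

section VectorCalculus

/-- The cross product on Euclidean space, as a bounded linear map of its second argument. -/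
def cross (a : E3) : E3 →L[ℝ] E3 :=
  LinearMap.toContinuousLinearMap <|
    (WithLp.linearEquiv 2 ℝ (Fin 3 → ℝ)).symm.toLinearMap ∘ₗ
      crossProduct (WithLp.ofLp a) ∘ₗ (WithLp.linearEquiv 2 ℝ (Fin 3 → ℝ)).toLinearMap

theorem ofLp_cross (a b : E3) :
    WithLp.ofLp (cross a b) = crossProduct (WithLp.ofLp a) (WithLp.ofLp b) :=
  rfl

theorem inner_cross (a b c : E3) : inner ℝ a (cross b c) =
    a 0 * (b 1 * c 2 - b 2 * c 1) + a 1 * (b 2 * c 0 - b 0 * c 2) +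
      a 2 * (b 0 * c 1 - b 1 * c 0) := by
  simp [PiLp.inner_apply, ofLp_cross, cross_apply, Fin.sum_univ_three, mul_comm]

theorem inner_cross_right (a b c : E3) : inner ℝ b (cross a c) = -inner ℝ (cross a b) c := by
  rw [real_inner_comm c, inner_cross, inner_cross]
  ring

theorem inner_cross_swap (a b c : E3) : inner ℝ b (cross a c) = -inner ℝ a (cross b c) := by
  rw [inner_cross, inner_cross]
  ring

theorem curl_eq_sum_cross (V : E3 → E3) (x : E3) :
    curl V x = ∑ i, cross (EuclideanSpace.single i 1)
      (fderiv ℝ V x (EuclideanSpace.single i 1)) := by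
  ext j
  fin_cases j <;>
    simp [curl, partialDeriv, Fin.sum_univ_three, ofLp_cross, cross_apply, sub_eq_add_neg, add_comm]

theorem IsTest.isTest_curl {V : E3 → E3} (hV : IsTest V) : IsTest (curl V) := by
  have h := hV.isTest_fderiv.clm_comp (∑ i, cross (EuclideanSpace.single i 1) ∘L
    .apply ℝ E3 (EuclideanSpace.single i 1))
  simpa [sum_apply, ← curl_eq_sum_cross] using h

theorem IsTest.integral_inner_cross_fderiv {V Φ : E3 → E3} (hV : IsTest V) (hΦ : IsTest Φ)
    (a v : E3) : ∫ x, inner ℝ (V x) (cross a (fderiv ℝ Φ x v)) =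
      ∫ x, inner ℝ (cross a (fderiv ℝ V x v)) (Φ x) := by
  have hparts : ∫ x, inner ℝ (cross a (V x)) (fderiv ℝ Φ x v) =
      -∫ x, inner ℝ (cross a (fderiv ℝ V x v)) (Φ x) :=
    hV.integral_bilin_fderiv_apply hΦ (innerSL ℝ ∘L cross a) v
  simp only [inner_cross_right, integral_neg, hparts, neg_neg]

theorem IsTest.integral_inner_curl {V Φ : E3 → E3} (hV : IsTest V) (hΦ : IsTest Φ) :
    ∫ x, inner ℝ (V x) (curl Φ x) = ∫ x, inner ℝ (curl V x) (Φ x) := by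
  have hcross {U : E3 → E3} (hU : IsTest U) (i : Fin 3) :=
    (hU.isTest_fderiv_apply (EuclideanSpace.single i 1)).clm_comp
      (cross (EuclideanSpace.single i 1))
  simp only [curl_eq_sum_cross, inner_sum, sum_inner]
  rw [integral_finsetSum _ fun i _ => (hV.isTest_inner (hcross hΦ i)).integrable,
    integral_finsetSum _ fun i _ => ((hcross hV i).isTest_inner hΦ).integrable]
  exact Finset.sum_congr rfl fun i _ => hV.integral_inner_cross_fderiv hΦ _ _

theorem IsTest.hasWeakCurl {V : E3 → E3} (hV : IsTest V) :
    HasWeakCurl V (curl V) :=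
  ⟨hV.integrable.locallyIntegrable, hV.isTest_curl.integrable.locallyIntegrable,
    fun _ hΦ => hV.integral_inner_curl hΦ⟩

theorem IsTest.hasWeakGradient {f : E3 → ℝ} (hf : IsTest f) :
    HasWeakGradient f (gradient f) := by
  refine ⟨hf.integrable.locallyIntegrable, hf.isTest_gradient.integrable.locallyIntegrable,
    fun η hη => ext_inner_left ℝ fun v => ?_⟩
  have hint : Integrable fun x => f x • gradient η x :=
    (hf.bilin hη.isTest_gradient (.lsmul ℝ ℝ)).integrable
  have hint' : Integrable fun x => η x • gradient f x :=
    (hη.bilin hf.isTest_gradient (.lsmul ℝ ℝ)).integrable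
  have hparts : ∫ x, f x * fderiv ℝ η x v = -∫ x, fderiv ℝ f x v * η x :=
    hf.integral_bilin_fderiv_apply hη (.mul ℝ ℝ) v
  rw [inner_neg_right, ← integral_inner hint, ← integral_inner hint']
  simpa [real_inner_smul_right, inner_gradient_right, mul_comm] using hparts

/-- The classical divergence of a differentiable vector field. -/
def divergence (V : E3 → E3) (x : E3) : ℝ :=
  ∑ i, partialDeriv i i V x

theorem IsTest.divergence_curl {V : E3 → E3} (hV : IsTest V) (x : E3) :
    divergence (curl V) x = 0 := by
  let e : Fin 3 → E3 := fun i => EuclideanSpace.single i 1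
  let D (i j : Fin 3) : E3 := fderiv ℝ (fun y => fderiv ℝ V y (e j)) x (e i)
  have hsymm (i j : Fin 3) : D i j = D j i := hV.fderiv_fderiv_comm _ _ x
  have hfderiv (i : Fin 3) :
      fderiv ℝ (curl V) x (e i) = ∑ j, cross (e j) (D i j) := by
    have h := HasFDerivAt.fun_sum (u := Finset.univ) fun j _ =>
      (cross (e j)).hasFDerivAt.comp x ((hV.isTest_fderiv_apply (e j)).differentiable x).hasFDerivAt
    rw [funext (curl_eq_sum_cross V)]
    simpa [D, sum_apply] using DFunLike.congr_fun h.fderiv (e i)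
  have hdiv : divergence (curl V) x = ∑ i, ∑ j, inner ℝ (e i) (cross (e j) (D i j)) := by
    simp only [← inner_sum, ← hfderiv]
    simp [divergence, partialDeriv, e, EuclideanSpace.inner_single_left]
  have hanti : ∑ i, ∑ j, inner ℝ (e i) (cross (e j) (D i j)) =
      -∑ i, ∑ j, inner ℝ (e i) (cross (e j) (D i j)) := by
    refine Finset.sum_comm.trans ?_
    simp only [← Finset.sum_neg_distrib]
    refine Finset.sum_congr rfl fun i _ => Finset.sum_congr rfl fun j _ => ?_
    rw [inner_cross_swap, hsymm]
  rw [hdiv]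
  linarith

theorem HasWeakGradient.integral_mul_fderiv {φ η : E3 → ℝ} {G : E3 → E3}
    (h : HasWeakGradient φ G) (hη : IsTest η) (v : E3) :
    ∫ x, φ x * fderiv ℝ η x v = -∫ x, η x * inner ℝ v (G x) := by
  have hη' := hη.isTest_gradient
  have hint := h.1.integrable_smul_right_of_hasCompactSupport hη'.1.continuous hη'.2
  have hint' := h.2.1.integrable_smul_left_of_hasCompactSupport hη.1.continuous hη.2
  have hv := congrArg (inner ℝ v) (h.2.2 η hη)
  rw [inner_neg_right, ← integral_inner hint, ← integral_inner hint'] at hv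
  simpa [real_inner_smul_right, inner_gradient_right] using hv

theorem HasWeakGradient.integral_inner {φ : E3 → ℝ} {G W : E3 → E3} (h : HasWeakGradient φ G)
    (hW : IsTest W) : ∫ x, inner ℝ (G x) (W x) = -∫ x, φ x * divergence W x := by
  let e : Fin 3 → E3 := fun i => EuclideanSpace.single i 1
  have hWi (i : Fin 3) : IsTest fun x => W x i :=
    hW.clm_comp (EuclideanSpace.proj i : E3 →L[ℝ] ℝ)
  have hderiv (i : Fin 3) (x : E3) : partialDeriv i i W x = fderiv ℝ (fun y => W y i) x (e i) :=
    DFunLike.congr_fun ((EuclideanSpace.proj i : E3 →L[ℝ] ℝ).hasFDerivAt.comp x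
      (hW.differentiable x).hasFDerivAt).fderiv.symm (e i)
  have hinner (x : E3) : inner ℝ (G x) (W x) = ∑ i, W x i * inner ℝ (e i) (G x) := by
    simp [PiLp.inner_apply, e]
  have hint (i : Fin 3) : Integrable fun x => W x i * inner ℝ (e i) (G x) := by
    simpa only [real_inner_smul_right] using
      (h.2.1.integrable_smul_left_of_hasCompactSupport (hWi i).1.continuous
        (hWi i).2).const_inner (𝕜 := ℝ) (e i)
  have hint' (i : Fin 3) : Integrable fun x => φ x * fderiv ℝ (fun y => W y i) x (e i) :=
    have hWi' := (hWi i).isTest_fderiv_apply (e i)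
    h.1.integrable_smul_right_of_hasCompactSupport hWi'.1.continuous hWi'.2
  simp only [hinner, divergence, hderiv, Finset.mul_sum]
  rw [integral_finsetSum _ fun i _ => hint i, integral_finsetSum _ fun i _ => hint' i,
    ← Finset.sum_neg_distrib]
  exact Finset.sum_congr rfl fun i _ => by rw [h.integral_mul_fderiv (hWi i), neg_neg]

theorem HasWeakGradient.hasWeakCurl_zero {φ : E3 → ℝ} {G : E3 → E3} (h : HasWeakGradient φ G) :
    HasWeakCurl G 0 := by
  refine ⟨h.2.1, locallyIntegrable_zero, fun Φ hΦ => ?_⟩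
  simp [h.integral_inner hΦ.isTest_curl, hΦ.divergence_curl]

end VectorCalculus

instance fact_one_le_three_halves : Fact ((1 : ℝ≥0∞) ≤ 3 / 2) :=
  ⟨by rw [ENNReal.le_div_iff_mul_le (by simp) (by simp)]; norm_num⟩

instance fact_one_le_three : Fact ((1 : ℝ≥0∞) ≤ 3) := ⟨by norm_num⟩

instance holderConjugate_three_three_halves : ENNReal.HolderConjugate 3 (3 / 2) where
  inv_add_inv_eq_inv := by
    rw [ENNReal.inv_div (by simp) (by simp), inv_one, ENNReal.div_eq_inv_mul, ← mul_one_add,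
      add_comm 1, two_add_one_eq_three]
    exact ENNReal.inv_mul_cancel (by simp) (by simp)

/-- Vector fields on `ℝ³` in `L^p`. -/
abbrev LpField (p : ℝ≥0∞) : AddSubgroup (E3 →ₘ[volume] E3) :=
  Lp E3 p (volume : Measure E3)

section WeakDerivatives

theorem HasWeakGradient.congr_ae {φ : E3 → ℝ} {G G' : E3 → E3} (h : HasWeakGradient φ G)
    (hG : G =ᵐ[volume] G') : HasWeakGradient φ G' := by
  refine ⟨h.1, h.2.1.congr hG, fun η hη => (h.2.2 η hη).trans ?_⟩
  congr 1
  exact integral_congr_ae (hG.mono fun x hx => by simp only [hx])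

theorem HasWeakGradient.add {φ ψ : E3 → ℝ} {G H : E3 → E3} (h : HasWeakGradient φ G)
    (h' : HasWeakGradient ψ H) : HasWeakGradient (φ + ψ) (G + H) := by
  refine ⟨h.1.add h'.1, h.2.1.add h'.2.1, fun η hη => ?_⟩
  have hg := hη.isTest_gradient
  simp only [Pi.add_apply, add_smul, smul_add]
  rw [integral_add (h.1.integrable_smul_right_of_hasCompactSupport hg.1.continuous hg.2)
      (h'.1.integrable_smul_right_of_hasCompactSupport hg.1.continuous hg.2),
    integral_add (h.2.1.integrable_smul_left_of_hasCompactSupport hη.1.continuous hη.2)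
      (h'.2.1.integrable_smul_left_of_hasCompactSupport hη.1.continuous hη.2),
    h.2.2 η hη, h'.2.2 η hη, neg_add]

theorem HasWeakGradient.const_smul {φ : E3 → ℝ} {G : E3 → E3} (h : HasWeakGradient φ G) (c : ℝ) :
    HasWeakGradient (c • φ) (c • G) := by
  refine ⟨h.1.smul c, h.2.1.smul c, fun η hη => ?_⟩
  simp only [Pi.smul_apply, smul_comm _ c, smul_assoc]
  rw [integral_smul, integral_smul, h.2.2 η hη, smul_neg]

theorem HasWeakCurl.congr_ae {A A' B B' : E3 → E3} (h : HasWeakCurl A B) (hA : A =ᵐ[volume] A')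
    (hB : B =ᵐ[volume] B') : HasWeakCurl A' B' := by
  refine ⟨h.1.congr hA, h.2.1.congr hB, fun Φ hΦ => ?_⟩
  have hA' : ∫ x, inner ℝ (A x) (curl Φ x) = ∫ x, inner ℝ (A' x) (curl Φ x) :=
    integral_congr_ae (hA.mono fun x hx => by simp only [hx])
  have hB' : ∫ x, inner ℝ (B x) (Φ x) = ∫ x, inner ℝ (B' x) (Φ x) :=
    integral_congr_ae (hB.mono fun x hx => by simp only [hx])
  rw [← hA', ← hB', h.2.2 Φ hΦ]

/-- The subspace of gradients in `L³`. -/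
def gradientSubmodule : Submodule ℝ (LpField 3) where
  carrier := {G | ∃ φ, HasWeakGradient φ G}
  zero_mem' := by
    refine ⟨0, HasWeakGradient.congr_ae (G := 0) ?_ (Lp.coeFn_zero _ _ _).symm⟩
    exact ⟨locallyIntegrable_zero, locallyIntegrable_zero, fun η _ => by simp⟩
  add_mem' := by
    rintro f g ⟨φ, hφ⟩ ⟨ψ, hψ⟩
    exact ⟨_, (hφ.add hψ).congr_ae (Lp.coeFn_add f g).symm⟩
  smul_mem' := by
    rintro c f ⟨φ, hφ⟩
    exact ⟨_, (hφ.const_smul c).congr_ae (Lp.coeFn_smul c f).symm⟩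

/-- The graph of the weak curl in `L³ × L^{3/2}`, cut out by the pairings with test fields so that
it is visibly a closed subspace. -/
def curlGraph : Submodule ℝ (LpField 3 × LpField (3 / 2)) :=
  ⨅ Φ : {Φ : E3 → E3 // IsTest Φ},
    ((lpToDual ((Φ.2.isTest_curl.memLp (3 / 2)).toLp) : StrongDual ℝ (LpField 3)) ∘L
        .fst ℝ (LpField 3) (LpField (3 / 2)) -
      (lpToDual ((Φ.2.memLp 3).toLp) : StrongDual ℝ (LpField (3 / 2))) ∘L
        .snd ℝ (LpField 3) (LpField (3 / 2))).ker

theorem isClosed_curlGraph : IsClosed (curlGraph : Set (LpField 3 × LpField (3 / 2))) := by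
  rw [curlGraph, Submodule.coe_iInf]
  exact isClosed_iInter fun Φ => ContinuousLinearMap.isClosed_ker _

theorem mem_curlGraph_iff {d : LpField 3 × LpField (3 / 2)} :
    d ∈ curlGraph ↔ HasWeakCurl d.1 d.2 := by
  simp only [curlGraph, Submodule.mem_iInf, LinearMap.mem_ker, ContinuousLinearMap.coe_coe,
    sub_apply, ContinuousLinearMap.comp_apply, sub_eq_zero,
    ContinuousLinearMap.coe_fst', ContinuousLinearMap.coe_snd',
    Subtype.forall, lpToDual_toLp_left]
  exact ⟨fun h => ⟨(Lp.memLp d.1).locallyIntegrable Fact.out,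
    (Lp.memLp d.2).locallyIntegrable Fact.out, h⟩, fun h => h.2.2⟩

theorem HasWeakCurl.mem_curlGraph {A B : E3 → E3} (h : HasWeakCurl A B)
    (hA : MemLp A 3 volume) (hB : MemLp B (3 / 2) volume) : (hA.toLp, hB.toLp) ∈ curlGraph :=
  mem_curlGraph_iff.2 (h.congr_ae hA.coeFn_toLp.symm hB.coeFn_toLp.symm)

theorem mk_zero_mem_curlGraph {G : LpField 3} (hG : G ∈ gradientSubmodule.topologicalClosure) :
    (G, 0) ∈ curlGraph := by
  refine closure_minimal (t := {G | (G, (0 : LpField (3 / 2))) ∈ curlGraph}) ?_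
    (isClosed_curlGraph.preimage (by fun_prop)) hG
  rintro G ⟨φ, hφ⟩
  exact mem_curlGraph_iff.2
    (hφ.hasWeakCurl_zero.congr_ae .rfl (Lp.coeFn_zero _ _ _).symm)

end WeakDerivatives

section SobolevConstant

theorem gaugeSeminorm_eq_infDist {A : E3 → E3} (hA : MemLp A 3) :
    gaugeSeminorm A = Metric.infDist hA.toLp gradientSubmodule := by
  rw [gaugeSeminorm, Metric.infDist_eq_iInf, iInf]
  congr 1
  ext r
  constructor
  · rintro ⟨φ, G, hφ, hG, rfl⟩
    refine ⟨⟨hG.toLp, φ, hφ.congr_ae hG.coeFn_toLp.symm⟩, ?_⟩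
    rw [lpNorm_eq_norm_toLp (hA.sub hG), MemLp.toLp_sub hA hG]
    exact dist_eq_norm _ _
  · rintro ⟨⟨G, φ, hφ⟩, rfl⟩
    refine ⟨φ, G, hφ, Lp.memLp G, ?_⟩
    rw [lpNorm_eq_norm_toLp (hA.sub (Lp.memLp G)), MemLp.toLp_sub hA (Lp.memLp G), Lp.toLp_coeFn]
    exact dist_eq_norm _ _

theorem MemY.hasWeakCurl {A : E3 → E3} (hA : MemY A) : HasWeakCurl A (weakCurl A) := by
  obtain ⟨-, B, -, h⟩ := hA
  exact h.weakCurl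

theorem MemY.memLp_weakCurl {A : E3 → E3} (hA : MemY A) : MemLp (weakCurl A) (3 / 2) := by
  obtain ⟨-, B, hB, h⟩ := hA
  exact hB.ae_eq (h.ae_eq h.weakCurl)

theorem memY_of_mem_curlGraph {d : LpField 3 × LpField (3 / 2)} (hd : d ∈ curlGraph) : MemY d.1 :=
  ⟨Lp.memLp d.1, d.2, Lp.memLp d.2, mem_curlGraph_iff.1 hd⟩

theorem weakCurl_ae_eq_of_mem_curlGraph {d : LpField 3 × LpField (3 / 2)} (hd : d ∈ curlGraph) :
    weakCurl d.1 =ᵐ[volume] d.2 :=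
  (mem_curlGraph_iff.1 hd).weakCurl.ae_eq (mem_curlGraph_iff.1 hd)

theorem gaugeSeminorm_nonneg (A : E3 → E3) : 0 ≤ gaugeSeminorm A :=
  Real.sInf_nonneg (by rintro _ ⟨_, _, _, _, rfl⟩; exact lpNorm_nonneg)

theorem sobolevQuotient_nonneg (A : E3 → E3) : 0 ≤ sobolevQuotient A :=
  div_nonneg (Real.rpow_nonneg lpNorm_nonneg _) (Real.rpow_nonneg (gaugeSeminorm_nonneg A) _)

theorem sobolevConst_nonneg : 0 ≤ sobolevConst :=
  Real.sInf_nonneg (by rintro _ ⟨A, -, -, rfl⟩; exact sobolevQuotient_nonneg A)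

theorem sobolevConst_mul_gaugeSeminorm_rpow_le {A : E3 → E3} (hA : MemY A) :
    sobolevConst * gaugeSeminorm A ^ (3 / 2 : ℝ) ≤
      lpNorm (weakCurl A) (3 / 2) volume ^ (3 / 2 : ℝ) := by
  rcases (gaugeSeminorm_nonneg A).eq_or_lt with h | h
  · rw [← h, Real.zero_rpow (by norm_num), mul_zero]
    exact Real.rpow_nonneg lpNorm_nonneg _
  · rw [← le_div_iff₀ (by positivity)]
    exact csInf_le ⟨0, by rintro _ ⟨A, -, -, rfl⟩; exact sobolevQuotient_nonneg A⟩
      ⟨A, hA, h.ne', rfl⟩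

theorem sobolevConst_mul_infDist_rpow_le {d : LpField 3 × LpField (3 / 2)} (hd : d ∈ curlGraph) :
    sobolevConst * Metric.infDist d.1 gradientSubmodule ^ (3 / 2 : ℝ) ≤ ‖d.2‖ ^ (3 / 2 : ℝ) := by
  have hY := memY_of_mem_curlGraph hd
  have hgauge : gaugeSeminorm d.1 = Metric.infDist d.1 gradientSubmodule := by
    rw [gaugeSeminorm_eq_infDist (Lp.memLp d.1), Lp.toLp_coeFn]
  have hcurl : lpNorm (weakCurl d.1) (3 / 2) volume = ‖d.2‖ := by
    rw [lpNorm_eq_norm_toLp hY.memLp_weakCurl, Lp.norm_toLp, Lp.norm_def,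
      eLpNorm_congr_ae (weakCurl_ae_eq_of_mem_curlGraph hd)]
  simpa only [hgauge, hcurl] using sobolevConst_mul_gaugeSeminorm_rpow_le hY

end SobolevConstant

section AlmostCritical

variable {hp : 1 < (3 : ℝ≥0∞).toReal} {hq : 1 < (3 / 2 : ℝ≥0∞).toReal}

theorem coeFn_lpDuality_three (f : LpField 3) :
    (lpDuality hp f : LpField (3 / 2)) =ᵐ[volume] fun x => ‖f x‖ • f x := by
  simpa [dualityMap_three] using coeFn_lpDuality (q := 3 / 2) hp f

theorem coeFn_lpDuality_three_halves (f : LpField (3 / 2)) :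
    (lpDuality hq f : LpField 3) =ᵐ[volume] fun x => ‖f x‖ ^ (-(1 / 2) : ℝ) • f x := by
  simpa [dualityMap_three_halves] using coeFn_lpDuality (q := 3) hq f

theorem weaklyDivFree_of_forall_lpToDual_eq_zero {v : LpField 3}
    (hv : ∀ G ∈ gradientSubmodule, lpToDual (lpDuality hp v : LpField (3 / 2)) G = 0) :
    WeaklyDivFree fun x => ‖v x‖ • v x := by
  have hcoe := coeFn_lpDuality_three (hp := hp) v
  have hloc : LocallyIntegrable (lpDuality hp v : LpField (3 / 2)) :=
    (Lp.memLp _).locallyIntegrable Fact.out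
  refine ⟨hloc.congr hcoe, fun η hη => ?_⟩
  have hg := hη.isTest_gradient.memLp 3
  rw [← hv hg.toLp ⟨η, hη.hasWeakGradient.congr_ae hg.coeFn_toLp.symm⟩, lpToDual_toLp]
  exact integral_congr_ae (hcoe.mono fun x hx => by simp only [hx])

theorem integral_sub_integral_eq_of_forall_mem_curlGraph {v r : LpField 3} {b : LpField (3 / 2)}
    {S : ℝ} (hvb : (v, b) ∈ curlGraph)
    (hr : ∀ d ∈ curlGraph, lpToDual (lpDuality hq b : LpField 3) d.2 -
      S * lpToDual (lpDuality hp v : LpField (3 / 2)) d.1 = lpToDual r d.2)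
    {Φ : E3 → E3} (hΦ : IsTest Φ) :
    (∫ x, inner ℝ (‖weakCurl v x‖ ^ (-(1 / 2) : ℝ) • weakCurl v x) (curl Φ x)) -
      S * ∫ x, inner ℝ (‖v x‖ • v x) (Φ x) = ∫ x, inner ℝ (r x) (curl Φ x) := by
  have h := hr _ (hΦ.hasWeakCurl.mem_curlGraph (hΦ.memLp 3) (hΦ.isTest_curl.memLp (3 / 2)))
  simp only [lpToDual_toLp] at h
  rw [← h]
  congr 1
  · refine integral_congr_ae ?_
    filter_upwards [weakCurl_ae_eq_of_mem_curlGraph hvb,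
      coeFn_lpDuality_three_halves (hq := hq) b] with x hcurl hdual
    rw [hcurl, hdual]
  · congr 1
    exact integral_congr_ae ((coeFn_lpDuality_three (hp := hp) v).mono fun x hx => by
      simp only [hx])

theorem MemY.exists_almost_critical {A : E3 → E3} (hA : MemY A) (hA1 : gaugeSeminorm A = 1) :
    ∃ A' r : E3 → E3, MemY A' ∧ WeaklyDivFree (fun x => ‖A' x‖ • A' x) ∧
      lpNorm A' 3 volume = 1 ∧ weakCurl A' =ᵐ[volume] weakCurl A ∧ MemLp r 3 volume ∧
      lpNorm r 3 volume ^ (3 : ℝ) ≤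
        8 * (lpNorm (weakCurl A) (3 / 2) volume ^ (3 / 2 : ℝ) - sobolevConst) ∧
      ∀ Φ : E3 → E3, IsTest Φ →
        (∫ x, inner ℝ (‖weakCurl A' x‖ ^ (-(1 / 2) : ℝ) • weakCurl A' x) (curl Φ x)) -
          sobolevConst * ∫ x, inner ℝ (‖A' x‖ • A' x) (Φ x) =
        ∫ x, inner ℝ (r x) (curl Φ x) := by
  set a : LpField 3 := hA.1.toLp
  set b : LpField (3 / 2) := hA.memLp_weakCurl.toLp
  have hdist (u : LpField 3) : Metric.infDist u gradientSubmodule.topologicalClosure =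
      Metric.infDist u gradientSubmodule :=
    Metric.infDist_closure
  obtain ⟨v, hav, hv, hvK⟩ := exists_sub_mem_forall_lpToDual_lpDuality_eq_zero (q := 3 / 2)
    (by norm_num) gradientSubmodule.isClosed_topologicalClosure a
  rw [hdist, ← gaugeSeminorm_eq_infDist, hA1] at hv
  have hvb : (v, b) ∈ curlGraph := by
    have h := curlGraph.sub_mem (hA.hasWeakCurl.mem_curlGraph hA.1 hA.memLp_weakCurl)
      (mk_zero_mem_curlGraph hav)
    rwa [Prod.mk_sub_mk, sub_sub_cancel, sub_zero] at h
  obtain ⟨r, hr, hrΓ⟩ := exists_norm_rpow_le_of_sobolev (by norm_num) sobolevConst_nonneg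
    (fun d hd => by simpa [← hdist] using sobolevConst_mul_infDist_rpow_le hd) (by norm_num)
    hvb hv hvK
  refine ⟨v, r, memY_of_mem_curlGraph hvb, weaklyDivFree_of_forall_lpToDual_eq_zero
    fun G hG => hvK G (gradientSubmodule.le_topologicalClosure hG), ?_,
    (weakCurl_ae_eq_of_mem_curlGraph hvb).trans hA.memLp_weakCurl.coeFn_toLp, Lp.memLp r, ?_,
    fun Φ hΦ => integral_sub_integral_eq_of_forall_mem_curlGraph hvb hrΓ hΦ⟩
  · rw [lpNorm_eq_norm_toLp (Lp.memLp v), Lp.toLp_coeFn, hv]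
  · rw [lpNorm_eq_norm_toLp (Lp.memLp r), Lp.toLp_coeFn, lpNorm_eq_norm_toLp hA.memLp_weakCurl]
    convert hr using 1 <;> norm_num [b]

end AlmostCritical

end CurlSobolev

end

theorem proposition8 (A : ℕ → CurlSobolev.E3 → CurlSobolev.E3)
    (hA : CurlSobolev.IsMinimizingSeq A)
    (hnorm : ∀ n, CurlSobolev.gaugeSeminorm (A n) = 1) :
    ∃ A' r : ℕ → CurlSobolev.E3 → CurlSobolev.E3,
      (∀ n, CurlSobolev.MemY (A' n) ∧
        CurlSobolev.WeaklyDivFree (fun x => ‖A' n x‖ • A' n x) ∧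
        lpNorm (A' n) 3 volume = 1) ∧
      Tendsto (fun n => eLpNorm (CurlSobolev.weakCurl (A' n) - CurlSobolev.weakCurl (A n))
        (3 / 2) volume) atTop (𝓝 0) ∧
      (∀ n, MemLp (r n) 3 volume) ∧
      Tendsto (fun n => eLpNorm (r n) 3 volume) atTop (𝓝 0) ∧
      ∀ n, ∀ Φ : CurlSobolev.E3 → CurlSobolev.E3, CurlSobolev.IsTest Φ →
        (∫ x, inner ℝ (‖CurlSobolev.weakCurl (A' n) x‖ ^ (-(1 / 2) : ℝ) •
            CurlSobolev.weakCurl (A' n) x) (CurlSobolev.curl Φ x)) -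
          CurlSobolev.sobolevConst * ∫ x, inner ℝ (‖A' n x‖ • A' n x) (Φ x) =
        ∫ x, inner ℝ (r n x) (CurlSobolev.curl Φ x) := by
  choose A' r hY hdiv hone hcurl hr hrle hEL using fun n =>
    (hA.1 n).1.exists_almost_critical (hnorm n)
  have hlim : Tendsto (fun n => 8 * (lpNorm (CurlSobolev.weakCurl (A n)) (3 / 2) volume ^
      (3 / 2 : ℝ) - CurlSobolev.sobolevConst)) atTop (𝓝 0) := by
    simpa [CurlSobolev.sobolevQuotient, hnorm] using
      (hA.2.sub_const CurlSobolev.sobolevConst).const_mul 8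
  have hzero (n : ℕ) : eLpNorm (CurlSobolev.weakCurl (A' n) - CurlSobolev.weakCurl (A n))
      (3 / 2) volume = 0 := by
    rw [eLpNorm_congr_ae (hcurl n).sub_eq, eLpNorm_zero]
  exact ⟨A', r, fun n => ⟨hY n, hdiv n, hone n⟩, by simp only [hzero, tendsto_const_nhds], hr,
    tendsto_eLpNorm_zero_of_lpNorm_rpow_le three_pos hr hlim hrle, hEL⟩
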